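/- Let $E\subset\mathbb R^d$ be a band, i.e. a Lebesgue measurable set of finite Lebesgue measure, and let $V_E=\{f\in L^2(\mathbb R^d): \hat f=0 \text{ a.e. outside } E\}$, where $\hat f(\xi)=\int_{\mathbb R^d} f(x)e^{-2\pi i x\cdot\xi}\,dx$ for $f\in L^1\cap L^2$ (extended to $L^2$ by continuity). Every $f\in V_E$ is identified with its continuous representative $f(y)=\int_{\mathbb R^d}\hat f(\xi)e^{2\pi i y\cdot\xi}\,d\xi$. Let $A_1,\dots,A_n$ be invertible real $d\times d$ matrices and $\beta_1,\dots,\beta_n\in\mathbb R^d$. The samples $\{A_jz+\beta_j: j=1,\dots,n;\ z\in\mathbb Z^d\}$ are called tight on $E$ if there is a constant $K$ such that for all $f\in V_E$ the sampled sequence $(f(A_jz+\beta_j))_{j,z}$ is square summable and $$\sum_{j=1}^n\sum_{z\in\mathbb Z^d}|f(A_jz+\beta_j)|^2=K\|f\|_{L^2}^2 .$$ Put $\Lambda=\bigcup_{j=1}^n (A_j^{*})^{-1}\mathbb Z^d$, where $A_j^*$ is the transpose of $A_j$, and, for $\alpha\in\Lambda$, $\mathcal P_\alpha=\{j\in\{1,\dots,n\}: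 A_j^*\alpha\in\mathbb Z^d\}$. Let $m$ be Lebesgue measure. Then the samples $\{A_jz+\beta_j: j=1,\dots,n;\ z\in\mathbb Z^d\}$ are tight on $E$ if and only if for each $\alpha\in\Lambda\setminus\{0\}$ either (1) $m(E\cap(E+\alpha))=0$, or (2) $\sum_{j\in\mathcal P_\alpha}|\det A_j|^{-1}e^{-2\pi i\beta_j\cdot\alpha}=0$. -/

import Mathlib

open MeasureTheory
open scoped FourierTransform

noncomputable section

namespace LatticeSampling

/-- The space `L²(ℝ^d)` of complex valued functions. -/
abbrev L2 (d : ℕ) : Type :=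
  Lp (α := EuclideanSpace ℝ (Fin d)) ℂ 2 (volume : Measure (EuclideanSpace ℝ (Fin d)))

/-- A band: a Lebesgue measurable subset of `ℝ^d` of finite measure. -/
structure IsBand {d : ℕ} (E : Set (EuclideanSpace ℝ (Fin d))) : Prop where
  measurable : NullMeasurableSet E volume
  finite : volume E < ⊤

/-- `V_E`: the functions in `L²(ℝ^d)` whose Fourier transform (in the `L²` sense, normalized with
`e^{-2π i x·ξ}`) vanishes almost everywhere outside of `E`. -/
def bandSpace {d : ℕ} (E : Set (EuclideanSpace ℝ (Fin d))) : Submodule ℂ (L2 d) where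
  carrier := {f | ∀ᵐ ξ, ξ ∉ E → (𝓕 f : L2 d) ξ = 0}
  zero_mem' := by
    simp only [Set.mem_ofPred_eq, FourierTransform.fourier_zero]
    filter_upwards [Lp.coeFn_zero ℂ 2 (volume : Measure (EuclideanSpace ℝ (Fin d)))] with ξ h _
    exact h
  add_mem' := by
    intro f g hf hg
    simp only [Set.mem_ofPred_eq, FourierTransform.fourier_add] at *
    filter_upwards [hf, hg, Lp.coeFn_add (𝓕 f : L2 d) (𝓕 g)] with ξ h1 h2 h3 h
    rw [h3, Pi.add_apply, h1 h, h2 h, add_zero]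
  smul_mem' := by
    intro c f hf
    simp only [Set.mem_ofPred_eq, FourierTransform.fourier_smul] at *
    filter_upwards [hf, Lp.coeFn_smul c (𝓕 f : L2 d)] with ξ h1 h2 h
    rw [h2, Pi.smul_apply, h1 h, smul_zero]

/-- The value `f(y) = ∫ f̂(ξ) e^{2π i y·ξ} dξ` at the point `y` of a band-limited function `f`.
For `f ∈ V_E` with `E` a band this integral converges absolutely, and `pointValue f` is the unique
continuous representative of `f`: see `integrable_fourier`, `continuous_pointValue` and
`pointValue_ae_eq`. -/
def pointValue {d : ℕ} (f : L2 d) (y : EuclideanSpace ℝ (Fin d)) : ℂ :=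
  𝓕⁻ (fun ξ => (𝓕 f : L2 d) ξ) y

theorem integrable_fourier {d : ℕ} {E : Set (EuclideanSpace ℝ (Fin d))} (hE : IsBand E)
    {f : L2 d} (hf : f ∈ bandSpace E) : Integrable (fun ξ => (𝓕 f : L2 d) ξ) volume := by
  have h1 : IntegrableOn (fun ξ => (𝓕 f : L2 d) ξ) E volume := by
    have : IsFiniteMeasure (volume.restrict E) := ⟨by simpa using hE.finite⟩
    exact ((Lp.memLp (𝓕 f : L2 d)).restrict E).integrable (by norm_num)
  have h2 : ∀ᵐ ξ, ξ ∉ E → (𝓕 f : L2 d) ξ = 0 := hf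
  exact h1.integrable_of_ae_notMem_eq_zero h2

theorem continuous_pointValue {d : ℕ} {E : Set (EuclideanSpace ℝ (Fin d))} (hE : IsBand E)
    {f : L2 d} (hf : f ∈ bandSpace E) : Continuous (pointValue f) := by
  have h := VectorFourier.fourierIntegral_continuous (μ := volume)
    (L := -(innerₗ (EuclideanSpace ℝ (Fin d)))) Real.continuous_fourierChar
    (continuous_inner (𝕜 := ℝ) (E := EuclideanSpace ℝ (Fin d))).neg
    (integrable_fourier hE hf)
  exact h

theorem pointValue_ae_eq {d : ℕ} {E : Set (EuclideanSpace ℝ (Fin d))} (hE : IsBand E)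
    {f : L2 d} (hf : f ∈ bandSpace E) : pointValue f =ᵐ[volume] f := by
  have hint := integrable_fourier hE hf
  refine ae_eq_of_integral_contDiff_smul_eq
    (continuous_pointValue hE hf).locallyIntegrable
    ((Lp.memLp f).locallyIntegrable (by norm_num)) ?_
  intro g hg hgc
  have hφc : HasCompactSupport (fun x => (g x : ℂ)) := hgc.comp_left Complex.ofReal_zero
  have hφs : ContDiff ℝ ((⊤ : ℕ∞) : WithTop ℕ∞) (fun x => (g x : ℂ)) :=
    Complex.ofRealCLM.contDiff.comp hg
  set φ : SchwartzMap (EuclideanSpace ℝ (Fin d)) ℂ := hφc.toSchwartzMap hφs with hφ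
  have hφx : ∀ x, φ x = (g x : ℂ) := fun x => rfl
  have e1 : ∫ x, φ x • pointValue f x = ∫ ξ, 𝓕⁻ (φ : EuclideanSpace ℝ (Fin d) → ℂ) ξ •
      (𝓕 f : L2 d) ξ := by
    have := VectorFourier.integral_fourierIntegral_smul_eq_flip (μ := volume) (ν := volume)
      (L := -(innerₗ (EuclideanSpace ℝ (Fin d)))) Real.continuous_fourierChar
      (continuous_inner (𝕜 := ℝ) (E := EuclideanSpace ℝ (Fin d))).neg
      (f := (φ : EuclideanSpace ℝ (Fin d) → ℂ)) φ.integrable hint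
    have hflip : (-(innerₗ (EuclideanSpace ℝ (Fin d)))).flip =
        -(innerₗ (EuclideanSpace ℝ (Fin d))) := by
      ext x y
      simp [real_inner_comm]
    rw [hflip] at this
    exact this.symm
  have e2 : ∫ ξ, (𝓕⁻ φ) ξ • (𝓕 f : L2 d) ξ = ∫ x, φ x • f x := by
    rw [← Lp.toTemperedDistribution_apply, ← TemperedDistribution.fourierInv_apply,
      Lp.fourierInv_toTemperedDistribution_eq, FourierTransform.fourierInv_fourier_eq,
      Lp.toTemperedDistribution_apply]
  rw [SchwartzMap.fourierInv_coe] at e2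
  have e3 := e1.trans e2
  simpa only [hφx, Complex.coe_smul] using e3

/-- The vector of `ℝ^d` with the integer coordinates `z`. -/
def intVec {d : ℕ} (z : Fin d → ℤ) : EuclideanSpace ℝ (Fin d) :=
  WithLp.toLp 2 (fun i => (z i : ℝ))

/-- A real `d × d` matrix acting on `ℝ^d`. -/
def act {d : ℕ} (M : Matrix (Fin d) (Fin d) ℝ) (x : EuclideanSpace ℝ (Fin d)) :
    EuclideanSpace ℝ (Fin d) :=
  WithLp.toLp 2 (M.mulVec x.ofLp)

/-- The sampling transform `Θ_A f = (f(A_j z + β_j))_{j, z}`. -/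
def samplingTransform {d n : ℕ} (A : Fin n → Matrix (Fin d) (Fin d) ℝ)
    (β : Fin n → EuclideanSpace ℝ (Fin d)) (f : L2 d) : Fin n × (Fin d → ℤ) → ℂ :=
  fun p => pointValue f (act (A p.1) (intVec p.2) + β p.1)

/-- The samples `{A_j z + β_j}` are tight on `E` if, for some constant `K`, every `f ∈ V_E` has
square summable samples with `‖Θ_A f‖² = K ‖f‖²`. -/
def IsTight {d n : ℕ} (A : Fin n → Matrix (Fin d) (Fin d) ℝ)
    (β : Fin n → EuclideanSpace ℝ (Fin d)) (E : Set (EuclideanSpace ℝ (Fin d))) : Prop :=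
  ∃ K : ℝ, ∀ f ∈ bandSpace E,
    HasSum (fun p : Fin n × (Fin d → ℤ) => ‖samplingTransform A β f p‖ ^ 2) (K * ‖f‖ ^ 2)

/-- `Λ = ⋃_j A_j' ℤ^d`, where `A' = (A^*)⁻¹`. -/
def dualUnion {d n : ℕ} (A : Fin n → Matrix (Fin d) (Fin d) ℝ) :
    Set (EuclideanSpace ℝ (Fin d)) :=
  ⋃ j, Set.range fun z : Fin d → ℤ => act (A j).transpose⁻¹ (intVec z)

open Classical in
/-- `P_α = {j : A_j^* α ∈ ℤ^d}`. -/
def indexSet {d n : ℕ} (A : Fin n → Matrix (Fin d) (Fin d) ℝ)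
    (α : EuclideanSpace ℝ (Fin d)) : Finset (Fin n) :=
  {j | ∃ z : Fin d → ℤ, act (A j).transpose α = intVec z}

end LatticeSampling

end

/-! Write F for the Fourier transform of f. A shift by β_j multiplies F by a character, so after the
substitution ξ = (A_j^*)⁻¹η the samples of f on A_j ℤ^d + β_j are, up to the factor |det A_j|⁻¹,
Fourier coefficients of a ℤ^d-periodization. Parseval on the torus and unfolding turn their energy
into a sum over the dual lattice of |det A_j|⁻¹ e^{-2πi β_j·γ} ∫ F(ξ) conj F(ξ+γ) dξ
(`hasSum_sq_fourierInv_lattice`). Summing over j gives Σ_{γ ∈ Λ} c(γ) ∫ F(ξ) conj F(ξ+γ) dξ, where c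
is the sum in (2) (`hasSum_sq_fourierInv`). This is proved for bounded, compactly supported F, where
only finitely many γ contribute; the term γ = 0 is (Σ_j |det A_j|⁻¹)‖F‖².

Sufficiency: under (1) or (2) every term with γ ≠ 0 vanishes, which settles bounded, compactly
supported F. General F is reached by truncations F_N: Fatou gives the upper bound, and the
parallelogram law applied to F and 2F_N - F, two functions of equal modulus, gives the lower one
(`NoAliasing.hasSum`).

Necessity: if (1) fails at α, take a tiny set S of positive measure with S and S + α inside E, and
let F be a on S and b on S + α. Local finiteness of Λ leaves only γ = 0, α, -α, and varying a, b
forces c(α) = 0 (`coefficient_eq_zero_of_isTight`). -/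

noncomputable section

namespace LatticeSampling

open scoped ComplexConjugate

/-! ### Parseval on the unit cube -/

section Torus

attribute [local instance] instMeasureSpaceUnitAddCircle

local instance : IsProbabilityMeasure (volume : Measure UnitAddCircle) :=
  inferInstanceAs (IsProbabilityMeasure AddCircle.haarAddCircle)

/-- The half open unit cube. -/
def unitCube (d : ℕ) : Set (Fin d → ℝ) := {x | ∀ i, x i ∈ Set.Ioc (0 : ℝ) (0 + 1)}

theorem measurableSet_unitCube (d : ℕ) : MeasurableSet (unitCube d) :=
  MeasurableSet.univ_pi' fun _ => measurableSet_Ioc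

theorem mFourier_coe {d : ℕ} (z : Fin d → ℤ) (x : Fin d → ℝ) :
    UnitAddTorus.mFourier z (fun i => (x i : UnitAddCircle)) =
      (𝐞 (∑ i, (z i : ℝ) * x i) : ℂ) := by
  simp only [UnitAddTorus.mFourier, ContinuousMap.coe_mk, fourier_coe_apply,
    Real.fourierChar_apply, ← Complex.exp_sum]
  congr 1
  push_cast
  rw [Finset.mul_sum, Finset.sum_mul]
  refine Finset.sum_congr rfl fun i _ => ?_
  ring

/-- Parseval's identity on the unit cube. -/
theorem hasSum_sq_integral_unitCube {d : ℕ} {P : (Fin d → ℝ) → ℂ} (hP : Measurable P) {C : ℝ}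
    (hC : ∀ x, ‖P x‖ ≤ C) :
    HasSum (fun z : Fin d → ℤ =>
      ‖∫ x in unitCube d, (𝐞 (∑ i, (z i : ℝ) * x i) : ℂ) * P x‖ ^ 2)
      (∫ x in unitCube d, ‖P x‖ ^ 2) := by
  let p : UnitAddTorus (Fin d) → ℂ := fun t =>
    P (UnitAddTorus.measurableEquivPiIoc (fun _ => 0) t).1
  have hpm : Measurable p := hP.comp
    (measurable_subtype_coe.comp (UnitAddTorus.measurableEquivPiIoc (fun _ => 0)).measurable)
  have hpP : ∀ x ∈ unitCube d, p (fun i => (x i : UnitAddCircle)) = P x := by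
    intro x hx
    have := (UnitAddTorus.measurableEquivPiIoc (fun _ : Fin d => (0 : ℝ))).apply_symm_apply
      (⟨x, hx⟩ : {x : Fin d → ℝ // ∀ i, x i ∈ Set.Ioc (0 : ℝ) (0 + 1)})
    rw [UnitAddTorus.coe_symm_measurableEquivPiIoc_apply] at this
    simp only [p, this]
  have hmem : MemLp p 2 volume :=
    MemLp.of_bound hpm.aestronglyMeasurable C (Filter.Eventually.of_forall fun t => hC _)
  have hae := hmem.coeFn_toLp
  have key := UnitAddTorus.hasSum_sq_mFourierCoeff (hmem.toLp p)
  have e1 : ∫ t, ‖hmem.toLp p t‖ ^ 2 = ∫ x in unitCube d, ‖P x‖ ^ 2 := by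
    have h1 : ∫ t, ‖hmem.toLp p t‖ ^ 2 = ∫ t, ‖p t‖ ^ 2 :=
      integral_congr_ae (hae.mono fun t ht => by simp only [ht])
    rw [h1, UnitAddTorus.integral_preimage _ (fun _ => 0)]
    exact setIntegral_congr_fun (measurableSet_unitCube d) fun x hx => by simp only [hpP x hx]
  rw [e1] at key
  -- Fourier coefficients carry e(-z·x), inverse transforms carry e(z·x); reindexing by z ↦ -z
  -- reconciles them.
  refine ((Equiv.neg (Fin d → ℤ)).hasSum_iff.mpr key).congr_fun fun z => ?_
  have e2 : UnitAddTorus.mFourierCoeff (hmem.toLp p) (-z) = UnitAddTorus.mFourierCoeff p (-z) :=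
    integral_congr_ae (hae.mono fun t ht => by simp only [ht])
  simp only [Function.comp_apply, Equiv.neg_apply]
  rw [e2, UnitAddTorus.mFourierCoeff_eq_integral _ _ (fun _ => 0), neg_neg]
  congr 2
  refine setIntegral_congr_fun (measurableSet_unitCube d) fun x hx => ?_
  simp only [hpP x hx, mFourier_coe, smul_eq_mul]

end Torus

/-! ### Periodization and unfolding -/

/-- The vector with integer coordinates `k`, in the space of functions. -/
def intPi {d : ℕ} (k : Fin d → ℤ) : Fin d → ℝ := fun i => (k i : ℝ)

theorem intPi_add {d : ℕ} (k l : Fin d → ℤ) : intPi (k + l) = intPi k + intPi l := by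
  ext i; simp [intPi]

theorem hasSum_integral_unitCube_add {d : ℕ} {H : (Fin d → ℝ) → ℂ} (hH : Integrable H) :
    HasSum (fun k : Fin d → ℤ => ∫ x in unitCube d, H (x + intPi k)) (∫ x, H x) := by
  let s : (Fin d → ℤ) → Set (Fin d → ℝ) := fun k => (fun x => x - intPi k) ⁻¹' unitCube d
  have hs : ∀ k, MeasurableSet (s k) := fun k =>
    (measurable_id.sub_const _) (measurableSet_unitCube d)
  -- The cube is open at 0 and closed at 1, so each point lies in exactly one translate, read off
  -- from its ceilings with a shift by one.
  have hmem : ∀ k x, x ∈ s k ↔ ∀ i, ⌈x i⌉ = k i + 1 := by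
    intro k x
    simp only [s, Set.mem_preimage, unitCube, Set.mem_ofPred_eq, Set.mem_Ioc, intPi,
      Pi.sub_apply, Int.ceil_eq_iff]
    refine forall_congr' fun i => ?_
    push_cast
    constructor <;> rintro ⟨h1, h2⟩ <;> constructor <;> linarith
  have hU : ⋃ k, s k = Set.univ := by
    refine Set.eq_univ_of_forall fun x => Set.mem_iUnion.mpr ⟨fun i => ⌈x i⌉ - 1, ?_⟩
    rw [hmem]; intro i; ring
  have hd : Pairwise (Function.onFun Disjoint s) := by
    intro k l hkl
    refine Set.disjoint_left.mpr fun x hk hl => hkl ?_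
    rw [hmem] at hk hl
    ext i
    have := hk i; have := hl i; omega
  have key := hasSum_integral_iUnion hs hd (f := H) (μ := volume) hH.integrableOn
  rw [hU, setIntegral_univ] at key
  refine key.congr_fun fun k => ?_
  have := (measurePreserving_sub_right (volume : Measure (Fin d → ℝ)) (intPi k)).setIntegral_preimage_emb
    (MeasurableEquiv.subRight (intPi k)).measurableEmbedding (fun x => H (x + intPi k)) (unitCube d)
  simpa using this.symm

/-- The periodization of `G` with respect to the integer lattice. -/
def periodization {d : ℕ} (G : (Fin d → ℝ) → ℂ) (x : Fin d → ℝ) : ℂ := ∑' k, G (x + intPi k)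

theorem periodization_add {d : ℕ} (G : (Fin d → ℝ) → ℂ) (x : Fin d → ℝ) (l : Fin d → ℤ) :
    periodization G (x + intPi l) = periodization G x := by
  unfold periodization
  rw [← (Equiv.addLeft l).tsum_eq (fun k => G (x + intPi k))]
  simp [intPi_add, add_assoc]

/-- Makes periodizations finite sums, with one index set valid on a whole ball: if x and x + k are
both bounded, so is every coordinate of k. -/
theorem exists_finset_intPi {d : ℕ} {R : ℝ} {G : (Fin d → ℝ) → ℂ}
    (hR : ∀ x, R < ‖x‖ → G x = 0) (R' : ℝ) :
    ∃ s : Finset (Fin d → ℤ), ∀ x, ‖x‖ ≤ R' → ∀ k ∉ s, G (x + intPi k) = 0 := by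
  refine ⟨Finset.Icc (fun _ => -⌈R + R'⌉) (fun _ => ⌈R + R'⌉), fun x hx k hk => hR _ ?_⟩
  by_contra! h
  apply hk
  have hi : ∀ i, |(k i : ℝ)| ≤ R + R' := by
    intro i
    have h1 := (norm_le_pi_norm (x + intPi k) i).trans h
    have h2 := (norm_le_pi_norm x i).trans hx
    rw [Real.norm_eq_abs] at h1 h2
    have e : (k i : ℝ) = (x + intPi k) i - x i := by simp [intPi]
    rw [e]
    exact (abs_sub _ _).trans (add_le_add h1 h2)
  rw [Finset.mem_Icc, Pi.le_def, Pi.le_def, ← forall_and]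
  intro i
  obtain ⟨h1, h2⟩ := abs_le.mp ((hi i).trans (Int.le_ceil _))
  exact ⟨by exact_mod_cast h1, by exact_mod_cast h2⟩

theorem norm_le_one_of_mem_unitCube {d : ℕ} {x : Fin d → ℝ} (hx : x ∈ unitCube d) : ‖x‖ ≤ 1 := by
  rw [pi_norm_le_iff_of_nonneg zero_le_one]
  intro i
  have := hx i
  rw [Real.norm_eq_abs, abs_le]
  constructor <;> linarith [this.1, this.2]

/-- Unfolding: integrating against a periodic function amounts to integrating the periodization
over the unit cube. -/
theorem integral_mul_eq_integral_periodization_mul {d : ℕ} {R : ℝ} {G Φ : (Fin d → ℝ) → ℂ}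
    (hR : ∀ x, R < ‖x‖ → G x = 0) (hΦ : ∀ x k, Φ (x + intPi k) = Φ x)
    (hG : Integrable fun x => G x * Φ x) :
    ∫ x, G x * Φ x = ∫ x in unitCube d, periodization G x * Φ x := by
  obtain ⟨s, hs⟩ := exists_finset_intPi hR 1
  have h1 := hasSum_integral_unitCube_add hG
  simp only [hΦ] at h1
  have h2 : ∀ k ∉ s, ∫ x in unitCube d, G (x + intPi k) * Φ x = 0 := by
    intro k hk
    refine setIntegral_eq_zero_of_forall_eq_zero fun x hx => ?_
    rw [hs x (norm_le_one_of_mem_unitCube hx) k hk, zero_mul]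
  rw [h1.unique (hasSum_sum_of_ne_finset_zero h2), ← integral_finsetSum]
  · refine setIntegral_congr_fun (measurableSet_unitCube d) fun x hx => ?_
    simp only [periodization]
    rw [tsum_eq_sum (s := s) fun k hk => hs x (norm_le_one_of_mem_unitCube hx) k hk,
      Finset.sum_mul]
  · intro k _
    have := (hG.comp_add_right (intPi k)).integrableOn (s := unitCube d)
    simp only [hΦ] at this
    exact this

theorem integrable_of_bounded_of_support {d : ℕ} {G : (Fin d → ℝ) → ℂ} (hG : Measurable G)
    {C R : ℝ} (hC : ∀ x, ‖G x‖ ≤ C) (hR : ∀ x, R < ‖x‖ → G x = 0) : Integrable G := by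
  have h : IntegrableOn G (Metric.closedBall 0 R) :=
    Measure.integrableOn_of_bounded (measure_closedBall_lt_top).ne hG.aestronglyMeasurable
      (Filter.Eventually.of_forall hC)
  refine h.integrable_of_forall_notMem_eq_zero fun x hx => hR x ?_
  simpa using hx

theorem fourierChar_sum_add_intPi {d : ℕ} (z k : Fin d → ℤ) (x : Fin d → ℝ) :
    (𝐞 (∑ i, (z i : ℝ) * (x + intPi k) i) : ℂ) = (𝐞 (∑ i, (z i : ℝ) * x i) : ℂ) := by
  rw [← mFourier_coe, ← mFourier_coe]
  congr 1
  ext i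
  simp [intPi]

/-- Parseval's identity for the periodization of a bounded, compactly supported function. -/
theorem hasSum_sq_integral_fourierChar {d : ℕ} {G : (Fin d → ℝ) → ℂ} (hG : Measurable G)
    {C R : ℝ} (hC : ∀ x, ‖G x‖ ≤ C) (hR : ∀ x, R < ‖x‖ → G x = 0) :
    HasSum (fun z : Fin d → ℤ =>
      ((‖∫ x, (𝐞 (∑ i, (z i : ℝ) * x i) : ℂ) * G x‖ ^ 2 : ℝ) : ℂ))
      (∑ᶠ k : Fin d → ℤ, ∫ x, G x * conj (G (x + intPi k))) := by
  have hC0 : 0 ≤ C := (norm_nonneg _).trans (hC 0)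
  -- The radius must cover both the unit cube and the support of G.
  obtain ⟨s, hs⟩ := exists_finset_intPi hR (max 1 R)
  have hper : ∀ x, ‖x‖ ≤ max 1 R → periodization G x = ∑ k ∈ s, G (x + intPi k) :=
    fun x hx => tsum_eq_sum fun k hk => hs x hx k hk
  have hcube : ∀ x ∈ unitCube d, periodization G x = ∑ k ∈ s, G (x + intPi k) :=
    fun x hx => hper x ((norm_le_one_of_mem_unitCube hx).trans (le_max_left _ _))
  have hGk : ∀ k, Measurable fun x => G (x + intPi k) :=
    fun k => hG.comp (measurable_id.add_const _)
  have hprod : ∀ k, Integrable fun x => G x * conj (G (x + intPi k)) := by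
    intro k
    refine integrable_of_bounded_of_support (C := C * C) (R := R)
      (hG.mul (Complex.continuous_conj.measurable.comp (hGk k))) (fun x => ?_) fun x hx => ?_
    · rw [norm_mul, RCLike.norm_conj]
      exact mul_le_mul (hC _) (hC _) (norm_nonneg _) hC0
    · rw [hR x hx, zero_mul]
  have hGs : ∀ x, G x * conj (periodization G x) = ∑ k ∈ s, G x * conj (G (x + intPi k)) := by
    intro x
    by_cases hx : R < ‖x‖
    · simp [hR x hx]
    · rw [hper x ((not_lt.mp hx).trans (le_max_right _ _)), map_sum, Finset.mul_sum]
  have hzero : ∀ k ∉ s, ∫ x, G x * conj (G (x + intPi k)) = 0 := by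
    intro k hk
    refine integral_eq_zero_of_ae (Filter.Eventually.of_forall fun x => ?_)
    by_cases hx : R < ‖x‖
    · simp [hR x hx]
    · simp [hs x ((not_lt.mp hx).trans (le_max_right _ _)) k hk]
  have hfin : ∑ᶠ k : Fin d → ℤ, ∫ x, G x * conj (G (x + intPi k)) =
      ∑ k ∈ s, ∫ x, G x * conj (G (x + intPi k)) := by
    refine finsum_eq_sum_of_support_subset _ fun k hk => ?_
    by_contra h
    exact hk (hzero k h)
  have key := hasSum_sq_integral_unitCube (P := fun x => ∑ k ∈ s, G (x + intPi k))
    (Finset.measurable_fun_sum s fun k _ => hGk k) (C := ∑ k ∈ s, C)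
    fun x => norm_sum_le_of_le _ fun k _ => hC _
  -- Unfolding one of the two factors of |periodization|², with the conjugate of the other as the
  -- periodic function.
  have e1 : ((∫ x in unitCube d, ‖∑ k ∈ s, G (x + intPi k)‖ ^ 2 : ℝ) : ℂ) =
      ∑ᶠ k : Fin d → ℤ, ∫ x, G x * conj (G (x + intPi k)) := by
    rw [hfin, ← integral_finsetSum _ fun k _ => hprod k]
    simp only [← hGs]
    rw [integral_mul_eq_integral_periodization_mul hR
      (fun x k => by rw [periodization_add]) (by
        simp only [hGs]; exact integrable_finsetSum _ fun k _ => hprod k), ← integral_complex_ofReal]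
    refine setIntegral_congr_fun (measurableSet_unitCube d) fun x hx => ?_
    rw [hcube x hx, Complex.mul_conj, Complex.normSq_eq_norm_sq]
  rw [← e1]
  refine (Complex.hasSum_ofReal.mpr key).congr_fun fun z => ?_
  congr 3
  simp only [mul_comm _ (G _)]
  have hcont : Measurable fun x : Fin d → ℝ => (𝐞 (∑ i, (z i : ℝ) * x i) : ℂ) := by
    refine Continuous.measurable ?_
    have : Continuous fun t : ℝ => (𝐞 t : ℂ) :=
      continuous_subtype_val.comp Real.continuous_fourierChar
    exact this.comp (by fun_prop)
  rw [integral_mul_eq_integral_periodization_mul hR (fun x k => fourierChar_sum_add_intPi z k x)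
    (integrable_of_bounded_of_support (hG.mul hcont) (C := C) (R := R)
      (fun x => by rw [norm_mul, Circle.norm_coe, mul_one]; exact hC x) fun x hx => by rw [hR x hx, zero_mul])]
  refine setIntegral_congr_fun (measurableSet_unitCube d) fun x hx => ?_
  rw [hcube x hx, mul_comm]

/-! ### Linear changes of variable and the energy on one affine lattice -/

theorem act_add {d : ℕ} (M : Matrix (Fin d) (Fin d) ℝ) (x y : EuclideanSpace ℝ (Fin d)) :
    act M (x + y) = act M x + act M y := by
  simp [act, Matrix.mulVec_add]

theorem act_mul {d : ℕ} (M N : Matrix (Fin d) (Fin d) ℝ) (x : EuclideanSpace ℝ (Fin d)) :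
    act (M * N) x = act M (act N x) := by
  simp [act, Matrix.mulVec_mulVec]

theorem act_one {d : ℕ} (x : EuclideanSpace ℝ (Fin d)) : act 1 x = x := by
  simp [act]

theorem act_inv_act {d : ℕ} {M : Matrix (Fin d) (Fin d) ℝ} (hM : IsUnit M.det)
    (x : EuclideanSpace ℝ (Fin d)) : act M⁻¹ (act M x) = x := by
  rw [← act_mul, Matrix.nonsing_inv_mul _ hM, act_one]

theorem act_act_inv {d : ℕ} {M : Matrix (Fin d) (Fin d) ℝ} (hM : IsUnit M.det)
    (x : EuclideanSpace ℝ (Fin d)) : act M (act M⁻¹ x) = x := by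
  rw [← act_mul, Matrix.mul_nonsing_inv _ hM, act_one]

theorem inner_act {d : ℕ} (M : Matrix (Fin d) (Fin d) ℝ) (x y : EuclideanSpace ℝ (Fin d)) :
    inner ℝ x (act M y) = inner ℝ (act M.transpose x) y := by
  simp only [act, EuclideanSpace.inner_eq_star_dotProduct, star_trivial]
  rw [Matrix.mulVec_transpose, dotProduct_comm, Matrix.dotProduct_mulVec, dotProduct_comm]

theorem continuous_act {d : ℕ} (M : Matrix (Fin d) (Fin d) ℝ) : Continuous (act M) := by
  unfold act
  fun_prop

/-- The operator norm of M⁻¹, from the Euclidean to the sup norm; it carries bounded supports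
through the substitution. -/
theorem exists_norm_le_act {d : ℕ} {M : Matrix (Fin d) (Fin d) ℝ} (hM : IsUnit M.det) :
    ∃ c : ℝ, 0 ≤ c ∧ ∀ η : Fin d → ℝ, ‖η‖ ≤ c * ‖act M (WithLp.toLp 2 η)‖ := by
  let L : EuclideanSpace ℝ (Fin d) →L[ℝ] (Fin d → ℝ) := LinearMap.toContinuousLinearMap
    ((Matrix.toLin' M⁻¹).comp (EuclideanSpace.equiv (Fin d) ℝ).toLinearMap)
  refine ⟨‖L‖, norm_nonneg _, fun η => ?_⟩
  have h : L (act M (WithLp.toLp 2 η)) = η := by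
    change M⁻¹.mulVec (M.mulVec η) = η
    rw [Matrix.mulVec_mulVec, Matrix.nonsing_inv_mul _ hM, Matrix.one_mulVec]
  conv_lhs => rw [← h]
  exact L.le_opNorm _

theorem integral_act {d : ℕ} {M : Matrix (Fin d) (Fin d) ℝ} (hM : IsUnit M.det)
    {f : EuclideanSpace ℝ (Fin d) → ℂ} (hf : Measurable f) :
    ∫ η : Fin d → ℝ, f (act M (WithLp.toLp 2 η)) = ((|M.det|⁻¹ : ℝ) : ℂ) * ∫ v, f v := by
  have hdet : M.det ≠ 0 := hM.ne_zero
  have h1 := (PiLp.volume_preserving_toLp (Fin d)).integral_comp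
    (MeasurableEquiv.toLp 2 (Fin d → ℝ)).measurableEmbedding f
  have hm : Measurable fun η : Fin d → ℝ => f (WithLp.toLp 2 η) :=
    hf.comp (MeasurableEquiv.toLp 2 (Fin d → ℝ)).measurable
  have h2 := integral_map (μ := volume) (φ := Matrix.toLin' M)
    (Matrix.toLin' M).continuous_of_finiteDimensional.measurable.aemeasurable
    (f := fun η => f (WithLp.toLp 2 η)) hm.aestronglyMeasurable
  rw [Real.map_matrix_volume_pi_eq_smul_volume_pi hdet, integral_smul_measure] at h2
  rw [← h1, show ∫ η : Fin d → ℝ, f (act M (WithLp.toLp 2 η)) =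
    ∫ η, f (WithLp.toLp 2 (Matrix.toLin' M η)) from rfl, ← h2,
    ENNReal.toReal_ofReal (abs_nonneg _), abs_inv]
  simp

/-- The autocorrelation `∫ F(ξ) conj F(ξ + γ) dξ`. -/
def autocorrelation {d : ℕ} (F : EuclideanSpace ℝ (Fin d) → ℂ) (γ : EuclideanSpace ℝ (Fin d)) :
    ℂ :=
  ∫ ξ, F ξ * conj (F (ξ + γ))

theorem continuous_fourierChar_inner {d : ℕ} (y : EuclideanSpace ℝ (Fin d)) :
    Continuous fun v : EuclideanSpace ℝ (Fin d) => (𝐞 (inner ℝ v y) : ℂ) := by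
  have : Continuous fun t : ℝ => (𝐞 t : ℂ) :=
    continuous_subtype_val.comp Real.continuous_fourierChar
  exact this.comp (by fun_prop)

theorem fourierInv_eq_integral_mul {d : ℕ} (F : EuclideanSpace ℝ (Fin d) → ℂ)
    (y : EuclideanSpace ℝ (Fin d)) : 𝓕⁻ F y = ∫ v, (𝐞 (inner ℝ v y) : ℂ) * F v := by
  rw [Real.fourierInv_eq]
  simp only [Circle.smul_def, smul_eq_mul]

theorem conj_fourierChar (t : ℝ) : conj (𝐞 t : ℂ) = (𝐞 (-t) : ℂ) := by
  rw [AddChar.map_neg_eq_inv, Circle.coe_inv_eq_conj]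

theorem toLp_intPi {d : ℕ} (k : Fin d → ℤ) : WithLp.toLp 2 (intPi k) = intVec k := rfl

/-- The energy of the samples of `𝓕⁻ F` on one affine lattice. -/
theorem hasSum_sq_fourierInv_lattice {d : ℕ} {A : Matrix (Fin d) (Fin d) ℝ} (hA : IsUnit A.det)
    (β : EuclideanSpace ℝ (Fin d)) {F : EuclideanSpace ℝ (Fin d) → ℂ} (hF : Measurable F)
    {C R : ℝ} (hC : ∀ x, ‖F x‖ ≤ C) (hR : ∀ x, R < ‖x‖ → F x = 0) :
    HasSum (fun z : Fin d → ℤ => ((‖𝓕⁻ F (act A (intVec z) + β)‖ ^ 2 : ℝ) : ℂ))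
      (∑ᶠ k : Fin d → ℤ, ((|A.det|⁻¹ : ℝ) : ℂ) *
        (𝐞 (-inner ℝ β (act A.transpose⁻¹ (intVec k))) : ℂ) *
        autocorrelation F (act A.transpose⁻¹ (intVec k))) := by
  have hdet : A.det ≠ 0 := hA.ne_zero
  have hT : IsUnit A.transpose.det := by rwa [Matrix.det_transpose]
  set B := A.transpose⁻¹ with hB
  have hBu : IsUnit B.det := Matrix.isUnit_nonsing_inv_det _ hT
  have hBdet : |B.det|⁻¹ = |A.det| := by
    rw [hB, Matrix.det_nonsing_inv, Matrix.det_transpose, Ring.inverse_eq_inv', abs_inv, inv_inv]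
  set H : EuclideanSpace ℝ (Fin d) → ℂ := fun v => (𝐞 (inner ℝ v β) : ℂ) * F v with hH
  have hHm : Measurable H := (continuous_fourierChar_inner β).measurable.mul hF
  have hBm : Measurable fun η : Fin d → ℝ => act B (WithLp.toLp 2 η) :=
    (continuous_act B).measurable.comp (MeasurableEquiv.toLp 2 (Fin d → ℝ)).measurable
  obtain ⟨c, hc0, hc⟩ := exists_norm_le_act hBu
  have key := hasSum_sq_integral_fourierChar (G := fun η => H (act B (WithLp.toLp 2 η)))
    (hHm.comp hBm) (C := C) (R := c * R)
    (fun η => by simp only [hH]; rw [norm_mul, Circle.norm_coe, one_mul]; exact hC _)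
    (fun η hη => by
      simp only [hH]
      rw [hR, mul_zero]
      by_contra! h
      exact absurd ((hc η).trans (mul_le_mul_of_nonneg_left h hc0)) (not_le.mpr hη))
  have e1 : ∀ z : Fin d → ℤ, ∫ x, (𝐞 (∑ i, (z i : ℝ) * x i) : ℂ) * H (act B (WithLp.toLp 2 x)) =
      ((|A.det| : ℝ) : ℂ) * 𝓕⁻ F (act A (intVec z) + β) := by
    intro z
    have hm : Measurable fun v => (𝐞 (inner ℝ v (act A (intVec z) + β)) : ℂ) * F v :=
      (continuous_fourierChar_inner _).measurable.mul hF
    rw [fourierInv_eq_integral_mul, ← hBdet, ← integral_act hBu hm]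
    refine integral_congr_ae (Filter.Eventually.of_forall fun x => ?_)
    simp only [hH]
    rw [inner_add_right, inner_act, act_act_inv hT, AddChar.map_add_eq_mul, Circle.coe_mul,
      mul_assoc]
    congr 4
  -- The modulations at v and v + Bk cancel up to the constant phase e(-β·Bk).
  have e2 : ∀ k : Fin d → ℤ, ∫ x, H (act B (WithLp.toLp 2 x)) *
      conj (H (act B (WithLp.toLp 2 (x + intPi k)))) =
      ((|A.det| : ℝ) : ℂ) * ((𝐞 (-inner ℝ β (act B (intVec k))) : ℂ) *
        autocorrelation F (act B (intVec k))) := by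
    intro k
    have hm : Measurable fun v => F v * conj (F (v + act B (intVec k))) :=
      hF.mul (Complex.continuous_conj.measurable.comp (hF.comp (measurable_id.add_const _)))
    rw [autocorrelation, ← integral_const_mul, ← hBdet, ← integral_act hBu (hm.const_mul _)]
    refine integral_congr_ae (Filter.Eventually.of_forall fun x => ?_)
    simp only [hH]
    rw [WithLp.toLp_add, toLp_intPi, act_add, map_mul, conj_fourierChar, inner_add_left, neg_add,
      AddChar.map_add_eq_mul, Circle.coe_mul, ← conj_fourierChar (inner ℝ _ β),
      real_inner_comm (act B (intVec k)) β]
    have h1 : (𝐞 (inner ℝ (act B (WithLp.toLp 2 x)) β) : ℂ) *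
        conj (𝐞 (inner ℝ (act B (WithLp.toLp 2 x)) β) : ℂ) = 1 := by
      rw [Complex.mul_conj, Circle.normSq_coe, Complex.ofReal_one]
    linear_combination (𝐞 (-inner ℝ (act B (intVec k)) β) : ℂ) * F (act B (WithLp.toLp 2 x)) *
      conj (F (act B (WithLp.toLp 2 x) + act B (intVec k))) * h1
  simp only [e1, e2] at key
  have hA0 : ((|A.det| : ℝ) : ℂ) ≠ 0 := by exact_mod_cast abs_ne_zero.mpr hdet
  -- Each coefficient is |det A| times a sample, so the energy is divided by |det A|²; the Jacobian
  -- |det A| in `e2` leaves |det A|⁻¹.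
  have key2 := key.mul_left (((|A.det|⁻¹ : ℝ) : ℂ) ^ 2)
  rw [mul_finsum] at key2
  rw [show ∑ᶠ k : Fin d → ℤ, ((|A.det|⁻¹ : ℝ) : ℂ) * (𝐞 (-inner ℝ β (act B (intVec k))) : ℂ) *
      autocorrelation F (act B (intVec k)) = _ from finsum_congr fun k => by
    rw [show ((|A.det|⁻¹ : ℝ) : ℂ) = ((|A.det|⁻¹ : ℝ) : ℂ) ^ 2 * ((|A.det| : ℝ) : ℂ) by
      push_cast; field_simp, mul_assoc, mul_assoc]]
  refine key2.congr_fun fun z => ?_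
  rw [norm_mul, mul_pow, Complex.norm_real, Real.norm_eq_abs, abs_abs]
  push_cast
  field_simp

/-! ### The energy of all samples -/

/-- The coefficient of the autocorrelation at `α` in the energy of all samples. -/
def coefficient {d n : ℕ} (A : Fin n → Matrix (Fin d) (Fin d) ℝ)
    (β : Fin n → EuclideanSpace ℝ (Fin d)) (α : EuclideanSpace ℝ (Fin d)) : ℂ :=
  ∑ j ∈ indexSet A α, ((|(A j).det|⁻¹ : ℝ) : ℂ) *
    Complex.exp (-2 * Real.pi * Complex.I * (inner ℝ (β j) α : ℝ))

theorem mem_indexSet {d n : ℕ} {A : Fin n → Matrix (Fin d) (Fin d) ℝ}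
    (hA : ∀ j, IsUnit (A j).det) (α : EuclideanSpace ℝ (Fin d)) (j : Fin n) :
    j ∈ indexSet A α ↔
      α ∈ Set.range fun z : Fin d → ℤ => act (A j).transpose⁻¹ (intVec z) := by
  have hT : IsUnit (A j).transpose.det := by rw [Matrix.det_transpose]; exact hA j
  simp only [indexSet, Finset.mem_filter, Finset.mem_univ, true_and, Set.mem_range]
  refine exists_congr fun z => ⟨fun h => ?_, fun h => ?_⟩
  · rw [← h, act_inv_act hT]
  · rw [← h, act_act_inv hT]

theorem intVec_injective {d : ℕ} : Function.Injective (intVec (d := d)) := by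
  intro z w h
  ext i
  have := congrArg (fun v : EuclideanSpace ℝ (Fin d) => v i) h
  simpa [intVec] using this

theorem hasSum_prod_of_fintype {ι κ M : Type*} [Fintype ι] [AddCommMonoid M] [TopologicalSpace M]
    [ContinuousAdd M] {f : ι × κ → M} {g : ι → M} (h : ∀ i, HasSum (fun k => f (i, k)) (g i)) :
    HasSum f (∑ i, g i) := by
  classical
  have h1 : ∀ i, HasSum (fun p : ι × κ => if p.1 = i then f p else 0) (g i) := by
    intro i
    rw [← (Prod.mk_right_injective i).hasSum_iff]
    · simpa [Function.comp_def] using h i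
    · rintro ⟨a, b⟩ hp
      refine if_neg ?_
      rintro rfl
      exact hp ⟨b, rfl⟩
  refine (hasSum_sum fun i _ => h1 i).congr_fun fun p => ?_
  simp

/-- The energy of all samples of `𝓕⁻ F`, in terms of the autocorrelation of `F`. -/
theorem hasSum_sq_fourierInv {d n : ℕ} {A : Fin n → Matrix (Fin d) (Fin d) ℝ}
    (hA : ∀ j, IsUnit (A j).det) (β : Fin n → EuclideanSpace ℝ (Fin d))
    {F : EuclideanSpace ℝ (Fin d) → ℂ} (hF : Measurable F)
    {C R : ℝ} (hC : ∀ x, ‖F x‖ ≤ C) (hR : ∀ x, R < ‖x‖ → F x = 0)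
    {S : Finset (EuclideanSpace ℝ (Fin d))}
    (hS : ∀ γ ∈ dualUnion A, autocorrelation F γ ≠ 0 → γ ∈ S) :
    HasSum (fun p : Fin n × (Fin d → ℤ) =>
      ((‖𝓕⁻ F (act (A p.1) (intVec p.2) + β p.1)‖ ^ 2 : ℝ) : ℂ))
      (∑ γ ∈ S, coefficient A β γ * autocorrelation F γ) := by
  classical
  let h : Fin n → EuclideanSpace ℝ (Fin d) → ℂ := fun j γ =>
    ((|(A j).det|⁻¹ : ℝ) : ℂ) * (𝐞 (-inner ℝ (β j) γ) : ℂ) * autocorrelation F γ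
  have e : ∑ γ ∈ S, coefficient A β γ * autocorrelation F γ =
      ∑ j, ∑ γ ∈ S, if j ∈ indexSet A γ then h j γ else 0 := by
    rw [Finset.sum_comm]
    refine Finset.sum_congr rfl fun γ _ => ?_
    rw [coefficient, Finset.sum_mul, ← Finset.sum_filter, Finset.filter_mem_eq_inter,
      Finset.univ_inter]
    refine Finset.sum_congr rfl fun j _ => ?_
    simp only [h, Real.fourierChar_apply]
    congr 3
    push_cast
    ring
  rw [e]
  refine hasSum_prod_of_fintype fun j => ?_
  have hT : IsUnit (A j).transpose.det := by rw [Matrix.det_transpose]; exact hA j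
  have hj := hasSum_sq_fourierInv_lattice (hA j) (β j) hF hC hR
  have hinj : Function.Injective fun z : Fin d → ℤ => act (A j).transpose⁻¹ (intVec z) := by
    intro z w hzw
    have := congrArg (act (A j).transpose) hzw
    simp only [act_act_inv hT] at this
    exact intVec_injective this
  -- The sum over k becomes a sum over points of the j-th dual lattice; those outside S have zero
  -- autocorrelation.
  have e3 : ∑ᶠ k, h j (act (A j).transpose⁻¹ (intVec k)) =
      ∑ γ ∈ S, if j ∈ indexSet A γ then h j γ else 0 := by
    rw [← finsum_mem_range (f := h j) hinj]
    simp only [← mem_indexSet hA, finsum_eq_if]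
    refine finsum_eq_sum_of_support_subset _ fun γ hγ => ?_
    rw [Function.mem_support] at hγ
    have hjγ : j ∈ indexSet A γ := by
      by_contra hh
      exact hγ (if_neg hh)
    rw [if_pos hjγ] at hγ
    exact hS γ (Set.mem_iUnion.mpr ⟨j, (mem_indexSet hA γ j).mp hjγ⟩) (right_ne_zero_of_mul hγ)
  rw [← e3]
  exact hj

/-- Λ need not be a group, but a finite union of lattices is still locally finite. -/
theorem finite_dualUnion_inter_closedBall {d n : ℕ} {A : Fin n → Matrix (Fin d) (Fin d) ℝ}
    (hA : ∀ j, IsUnit (A j).det) (R : ℝ) :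
    (dualUnion A ∩ Metric.closedBall 0 R).Finite := by
  classical
  rw [dualUnion, Set.iUnion_inter]
  refine Set.finite_iUnion fun j => ?_
  have hT : IsUnit (A j).transpose.det := by rw [Matrix.det_transpose]; exact hA j
  obtain ⟨c, hc0, hc⟩ := exists_norm_le_act (Matrix.isUnit_nonsing_inv_det _ hT)
  -- Applied to the indicator of a ball at x = 0, this says that the ball contains finitely many
  -- integer points.
  obtain ⟨s, hs⟩ := exists_finset_intPi (R := c * R)
    (G := fun η : Fin d → ℝ => if ‖η‖ ≤ c * R then 1 else 0)
    (fun x hx => if_neg (not_le.mpr hx)) 0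
  refine (s.finite_toSet.image fun z => act (A j).transpose⁻¹ (intVec z)).subset ?_
  rintro _ ⟨⟨z, rfl⟩, hz⟩
  refine ⟨z, ?_, rfl⟩
  by_contra hzs
  have h0 := hs 0 (by simp) z hzs
  rw [zero_add, if_pos] at h0
  · exact one_ne_zero h0
  · refine (hc _).trans (mul_le_mul_of_nonneg_left ?_ hc0)
    simpa [toLp_intPi] using hz

theorem integral_norm_sq_eq_norm_sq {d : ℕ} (f : L2 d) : ∫ x, ‖f x‖ ^ 2 = ‖f‖ ^ 2 := by
  have h := L2.inner_def (𝕜 := ℂ) f f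
  simp only [inner_self_eq_norm_sq_to_K] at h
  have h2 : ((‖f‖ ^ 2 : ℝ) : ℂ) = ((∫ x, ‖f x‖ ^ 2 : ℝ) : ℂ) := by
    rw [← integral_complex_ofReal]
    push_cast
    exact h
  exact_mod_cast h2.symm

theorem autocorrelation_zero {d : ℕ} (F : EuclideanSpace ℝ (Fin d) → ℂ) :
    autocorrelation F 0 = ((∫ x, ‖F x‖ ^ 2 : ℝ) : ℂ) := by
  rw [autocorrelation, ← integral_complex_ofReal]
  refine integral_congr_ae (Filter.Eventually.of_forall fun x => ?_)
  simp only [add_zero]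
  rw [Complex.mul_conj, Complex.normSq_eq_norm_sq]

theorem exists_ne_zero_of_autocorrelation_ne_zero {d : ℕ} {F : EuclideanSpace ℝ (Fin d) → ℂ}
    {γ : EuclideanSpace ℝ (Fin d)} (h : autocorrelation F γ ≠ 0) :
    ∃ ξ, F ξ ≠ 0 ∧ F (ξ + γ) ≠ 0 := by
  by_contra! hc
  refine h (integral_eq_zero_of_ae (Filter.Eventually.of_forall fun ξ => ?_))
  by_cases hξ : F ξ = 0
  · simp [hξ]
  · simp [hc ξ hξ]

theorem coefficient_zero {d n : ℕ} (A : Fin n → Matrix (Fin d) (Fin d) ℝ)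
    (β : Fin n → EuclideanSpace ℝ (Fin d)) :
    coefficient A β 0 = ((∑ j, |(A j).det|⁻¹ : ℝ) : ℂ) := by
  have h : indexSet A 0 = Finset.univ := by
    simp only [indexSet, Finset.filter_eq_self, Finset.mem_univ, true_imp_iff]
    intro j
    refine ⟨0, ?_⟩
    ext i
    simp [act, intVec]
  simp [coefficient, h]

/-- The pairs of translates of `F` seen by the samples do not contribute to their energy. -/
def NoAliasing {d n : ℕ} (A : Fin n → Matrix (Fin d) (Fin d) ℝ)
    (β : Fin n → EuclideanSpace ℝ (Fin d)) (F : EuclideanSpace ℝ (Fin d) → ℂ) : Prop :=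
  ∀ γ ∈ dualUnion A, γ ≠ 0 → coefficient A β γ = 0 ∨ ∀ᵐ ξ, F ξ = 0 ∨ F (ξ + γ) = 0

/-- The condition sees only the zero set, so F_N and 2F_N - F inherit it from F. -/
theorem NoAliasing.mono {d n : ℕ} {A : Fin n → Matrix (Fin d) (Fin d) ℝ}
    {β : Fin n → EuclideanSpace ℝ (Fin d)} {F G : EuclideanSpace ℝ (Fin d) → ℂ}
    (hF : NoAliasing A β F) (hG : ∀ ξ, F ξ = 0 → G ξ = 0) : NoAliasing A β G := by
  intro γ hγ h0
  refine (hF γ hγ h0).imp_right fun h => ?_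
  filter_upwards [h] with ξ hξ
  exact hξ.imp (hG _) (hG _)

theorem NoAliasing.hasSum_of_bounded {d n : ℕ} {A : Fin n → Matrix (Fin d) (Fin d) ℝ}
    (hA : ∀ j, IsUnit (A j).det) {β : Fin n → EuclideanSpace ℝ (Fin d)}
    {F : EuclideanSpace ℝ (Fin d) → ℂ} (hN : NoAliasing A β F) (hF : Measurable F)
    {C R : ℝ} (hC : ∀ x, ‖F x‖ ≤ C) (hR : ∀ x, R < ‖x‖ → F x = 0) :
    HasSum (fun p : Fin n × (Fin d → ℤ) => ‖𝓕⁻ F (act (A p.1) (intVec p.2) + β p.1)‖ ^ 2)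
      ((∑ j, |(A j).det|⁻¹) * ∫ x, ‖F x‖ ^ 2) := by
  classical
  have hfin := finite_dualUnion_inter_closedBall hA (R + R)
  -- Differences of points of the support have norm at most R + R. The point 0 is added by hand
  -- because Λ is empty when n = 0.
  have key := hasSum_sq_fourierInv hA β hF hC hR (S := insert 0 hfin.toFinset) (by
    intro γ hγ h
    obtain ⟨ξ, h1, h2⟩ := exists_ne_zero_of_autocorrelation_ne_zero h
    refine Finset.mem_insert_of_mem (hfin.mem_toFinset.mpr ⟨hγ, ?_⟩)
    have h1' := not_lt.mp fun hh => h1 (hR _ hh)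
    have h2' := not_lt.mp fun hh => h2 (hR _ hh)
    have := norm_sub_le (ξ + γ) ξ
    rw [add_sub_cancel_left] at this
    rw [mem_closedBall_zero_iff]
    linarith)
  rw [Finset.sum_eq_single 0] at key
  · rw [coefficient_zero, autocorrelation_zero, ← Complex.ofReal_mul] at key
    exact Complex.hasSum_ofReal.mp key
  · intro γ hγ h0
    have hγΛ : γ ∈ dualUnion A :=
      (hfin.mem_toFinset.mp (Finset.mem_of_mem_insert_of_ne hγ h0)).1
    rcases hN γ hγΛ h0 with h | h
    · rw [h, zero_mul]
    · rw [autocorrelation, integral_eq_zero_of_ae, mul_zero]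
      filter_upwards [h] with ξ hξ
      rcases hξ with hξ | hξ <;> simp [hξ]
  · intro h
    exact absurd (Finset.mem_insert_self _ _) h

/-! ### Truncation -/

/-- Truncation of `F` in space and in size. -/
def truncation {d : ℕ} (F : EuclideanSpace ℝ (Fin d) → ℂ) (N : ℕ) :
    EuclideanSpace ℝ (Fin d) → ℂ :=
  {x | ‖x‖ ≤ N ∧ ‖F x‖ ≤ N}.indicator F

section Truncation

variable {d : ℕ} {F : EuclideanSpace ℝ (Fin d) → ℂ}

theorem measurable_truncation (hF : Measurable F) (N : ℕ) : Measurable (truncation F N) :=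
  hF.indicator ((measurableSet_le measurable_norm measurable_const).inter
    (measurableSet_le hF.norm measurable_const))

theorem truncation_eq_or (N : ℕ) (x : EuclideanSpace ℝ (Fin d)) :
    truncation F N x = F x ∨ truncation F N x = 0 :=
  (Set.indicator_eq_zero_or_self _ F x).symm

theorem norm_truncation_le (N : ℕ) (x : EuclideanSpace ℝ (Fin d)) :
    ‖truncation F N x‖ ≤ ‖F x‖ :=
  norm_indicator_le_norm_self _ _

theorem norm_truncation_le_natCast (N : ℕ) (x : EuclideanSpace ℝ (Fin d)) :
    ‖truncation F N x‖ ≤ N := by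
  unfold truncation
  by_cases hx : x ∈ {x | ‖x‖ ≤ N ∧ ‖F x‖ ≤ N}
  · rw [Set.indicator_of_mem hx]; exact hx.2
  · rw [Set.indicator_of_notMem hx]; simp

theorem truncation_eq_zero {N : ℕ} {x : EuclideanSpace ℝ (Fin d)} (hx : (N : ℝ) < ‖x‖) :
    truncation F N x = 0 :=
  Set.indicator_of_notMem (fun h => absurd h.1 (not_le.mpr hx)) _

theorem tendsto_truncation (x : EuclideanSpace ℝ (Fin d)) :
    Filter.Tendsto (fun N => truncation F N x) Filter.atTop (nhds (F x)) := by
  refine tendsto_const_nhds.congr' ?_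
  filter_upwards [Filter.eventually_ge_atTop ⌈max ‖x‖ ‖F x‖⌉₊] with N hN
  have h := (Nat.le_ceil _).trans (Nat.cast_le (α := ℝ).mpr hN)
  exact (Set.indicator_of_mem (s := {x | ‖x‖ ≤ N ∧ ‖F x‖ ≤ N})
    ⟨(le_max_left _ _).trans h, (le_max_right _ _).trans h⟩ F).symm

theorem tendsto_fourierInv_truncation (hF : Measurable F) (hi : Integrable F)
    (y : EuclideanSpace ℝ (Fin d)) :
    Filter.Tendsto (fun N => 𝓕⁻ (truncation F N) y) Filter.atTop (nhds (𝓕⁻ F y)) := by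
  simp only [fourierInv_eq_integral_mul]
  refine tendsto_integral_of_dominated_convergence (fun x => ‖F x‖) (fun N => ?_) hi.norm
    (fun N => Filter.Eventually.of_forall fun x => ?_)
    (Filter.Eventually.of_forall fun x => (tendsto_truncation x).const_mul _)
  · exact ((continuous_fourierChar_inner y).measurable.mul
      (measurable_truncation hF N)).aestronglyMeasurable
  · rw [norm_mul, Circle.norm_coe, one_mul]
    exact norm_truncation_le N x

theorem tendsto_integral_norm_sq_truncation (hF : Measurable F)
    (h2 : Integrable fun x => ‖F x‖ ^ 2) :
    Filter.Tendsto (fun N => ∫ x, ‖truncation F N x‖ ^ 2) Filter.atTop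
      (nhds (∫ x, ‖F x‖ ^ 2)) := by
  refine tendsto_integral_of_dominated_convergence (fun x => ‖F x‖ ^ 2) (fun N => ?_) h2
    (fun N => Filter.Eventually.of_forall fun x => ?_)
    (Filter.Eventually.of_forall fun x => ((tendsto_truncation x).norm.pow 2))
  · exact ((measurable_truncation hF N).norm.pow_const 2).aestronglyMeasurable
  · rw [norm_pow, norm_norm]
    exact pow_le_pow_left₀ (norm_nonneg _) (norm_truncation_le N x) 2

theorem integrable_truncation (hF : Measurable F) (hi : Integrable F) (N : ℕ) :
    Integrable (truncation F N) :=
  hi.mono (measurable_truncation hF N).aestronglyMeasurable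
    (Filter.Eventually.of_forall (norm_truncation_le N))

end Truncation

/-! ### Sufficiency: from truncations to all of V_E -/

section Sufficiency

variable {d n : ℕ} {A : Fin n → Matrix (Fin d) (Fin d) ℝ}
  {β : Fin n → EuclideanSpace ℝ (Fin d)} {F : EuclideanSpace ℝ (Fin d) → ℂ}

theorem NoAliasing.truncation_hasSum (hA : ∀ j, IsUnit (A j).det) (hN : NoAliasing A β F)
    (hF : Measurable F) (N : ℕ) :
    HasSum (fun p : Fin n × (Fin d → ℤ) =>
      ‖𝓕⁻ (truncation F N) (act (A p.1) (intVec p.2) + β p.1)‖ ^ 2)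
      ((∑ j, |(A j).det|⁻¹) * ∫ x, ‖truncation F N x‖ ^ 2) :=
  (hN.mono fun ξ h => by simpa [h] using truncation_eq_or (F := F) N ξ).hasSum_of_bounded hA
    (measurable_truncation hF N) (norm_truncation_le_natCast N) fun _ => truncation_eq_zero

/-- Fatou's argument: a finite sum of samples passes to the limit along the truncations. -/
theorem NoAliasing.sum_le (hA : ∀ j, IsUnit (A j).det) (hN : NoAliasing A β F)
    (hF : Measurable F) (hi : Integrable F) (h2 : Integrable fun x => ‖F x‖ ^ 2)
    (s : Finset (Fin n × (Fin d → ℤ))) :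
    ∑ p ∈ s, ‖𝓕⁻ F (act (A p.1) (intVec p.2) + β p.1)‖ ^ 2 ≤
      (∑ j, |(A j).det|⁻¹) * ∫ x, ‖F x‖ ^ 2 := by
  refine le_of_tendsto_of_tendsto'
    (tendsto_finsetSum s fun p _ => ((tendsto_fourierInv_truncation hF hi
      (act (A p.1) (intVec p.2) + β p.1)).norm.pow 2))
    ((tendsto_integral_norm_sq_truncation hF h2).const_mul _) fun N => ?_
  exact sum_le_hasSum s (fun p _ => sq_nonneg _) (hN.truncation_hasSum hA hF N)

theorem NoAliasing.hasSum (hA : ∀ j, IsUnit (A j).det) (hN : NoAliasing A β F)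
    (hF : Measurable F) (hi : Integrable F) (h2 : Integrable fun x => ‖F x‖ ^ 2) :
    HasSum (fun p : Fin n × (Fin d → ℤ) => ‖𝓕⁻ F (act (A p.1) (intVec p.2) + β p.1)‖ ^ 2)
      ((∑ j, |(A j).det|⁻¹) * ∫ x, ‖F x‖ ^ 2) := by
  have hs : Summable fun p : Fin n × (Fin d → ℤ) =>
      ‖𝓕⁻ F (act (A p.1) (intVec p.2) + β p.1)‖ ^ 2 :=
    summable_of_sum_le (fun p => sq_nonneg _) (hN.sum_le hA hF hi h2)
  rw [hs.hasSum_iff]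
  refine le_antisymm (hs.tsum_le_of_sum_le (hN.sum_le hA hF hi h2)) ?_
  set K := ∑ j, |(A j).det|⁻¹
  have hstep : ∀ N : ℕ, 2 * (K * ∫ x, ‖truncation F N x‖ ^ 2) ≤
      ∑' p : Fin n × (Fin d → ℤ), ‖𝓕⁻ F (act (A p.1) (intVec p.2) + β p.1)‖ ^ 2 +
        K * ∫ x, ‖F x‖ ^ 2 := by
    intro N
    -- G is F with its sign flipped off the truncation set: |G| = |F|, so the upper bound holds for
    -- G with the same constant, and F_N is the midpoint of F and G.
    set G : EuclideanSpace ℝ (Fin d) → ℂ := fun x => 2 * truncation F N x - F x with hG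
    have hGm : Measurable G := ((measurable_truncation hF N).const_mul 2).sub hF
    have hGi : Integrable G := ((integrable_truncation hF hi N).const_mul 2).sub hi
    have hGn : ∀ x, ‖G x‖ = ‖F x‖ := by
      intro x
      simp only [hG]
      rcases truncation_eq_or (F := F) N x with h | h
      · rw [h]; congr 1; ring
      · rw [h]; simp
    have hGN : NoAliasing A β G := hN.mono fun ξ h => by
      rw [← norm_eq_zero, hGn, h, norm_zero]
    have hG2 : Integrable fun x => ‖G x‖ ^ 2 := by simpa only [hGn] using h2
    have hGsum := hGN.sum_le hA hGm hGi hG2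
    have hGs : Summable fun p : Fin n × (Fin d → ℤ) =>
        ‖𝓕⁻ G (act (A p.1) (intVec p.2) + β p.1)‖ ^ 2 :=
      summable_of_sum_le (fun p => sq_nonneg _) hGsum
    have hGle := hGs.tsum_le_of_sum_le hGsum
    simp only [hGn] at hGle
    have hlin : ∀ y, 𝓕⁻ G y = 2 * 𝓕⁻ (truncation F N) y - 𝓕⁻ F y := by
      intro y
      simp only [fourierInv_eq_integral_mul]
      have hint : ∀ {H : EuclideanSpace ℝ (Fin d) → ℂ}, Integrable H →
          Integrable fun v => (𝐞 (inner ℝ v y) : ℂ) * H v := fun hH =>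
        hH.bdd_mul (continuous_fourierChar_inner y).aestronglyMeasurable (c := 1)
          (Filter.Eventually.of_forall fun v => (Circle.norm_coe _).le)
      rw [← integral_const_mul, ← integral_sub
        ((hint (integrable_truncation hF hi N)).const_mul 2) (hint hi)]
      congr 1
      ext v
      simp only [hG]
      ring
    have hpt : ∀ y, 2 * ‖𝓕⁻ (truncation F N) y‖ ^ 2 ≤ ‖𝓕⁻ F y‖ ^ 2 + ‖𝓕⁻ G y‖ ^ 2 := by
      intro y
      rw [hlin]
      have := parallelogram_law_with_norm ℝ (𝓕⁻ (truncation F N) y)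
        (𝓕⁻ F y - 𝓕⁻ (truncation F N) y)
      rw [add_sub_cancel, show 𝓕⁻ (truncation F N) y - (𝓕⁻ F y - 𝓕⁻ (truncation F N) y) =
        2 * 𝓕⁻ (truncation F N) y - 𝓕⁻ F y by ring] at this
      nlinarith [mul_self_nonneg ‖𝓕⁻ F y - 𝓕⁻ (truncation F N) y‖]
    have := hasSum_le (fun p => hpt _) ((hN.truncation_hasSum hA hF N).mul_left 2)
      (hs.hasSum.add hGs.hasSum)
    linarith
  have := le_of_tendsto' (((tendsto_integral_norm_sq_truncation hF h2).const_mul K).const_mul 2)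
    hstep
  linarith

theorem isTight_of_forall (hA : ∀ j, IsUnit (A j).det) {E : Set (EuclideanSpace ℝ (Fin d))}
    (hE : IsBand E)
    (h : ∀ α ∈ dualUnion A, α ≠ 0 →
      (volume (E ∩ (fun x => x + α) '' E) = 0 ∨ coefficient A β α = 0)) :
    IsTight A β E := by
  refine ⟨∑ j, |(A j).det|⁻¹, fun f hf => ?_⟩
  have hN : NoAliasing A β (fun ξ => (𝓕 f : L2 d) ξ) := by
    intro γ hγ h0
    refine (h γ hγ h0).symm.imp_right fun h1 => ?_
    have hf' : ∀ᵐ ξ, ξ ∉ E → (𝓕 f : L2 d) ξ = 0 := hf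
    -- If F is nonzero at ξ and ξ + γ, then almost surely ξ + γ lies in E ∩ (E + γ), a null set.
    have h2 := (measurePreserving_add_right volume γ).quasiMeasurePreserving.ae hf'
    have h3 := (measurePreserving_add_right volume γ).quasiMeasurePreserving.ae
      (measure_eq_zero_iff_ae_notMem.mp h1)
    filter_upwards [hf', h2, h3] with ξ h4 h5 h6
    by_contra! hc
    refine h6 ⟨by_contra fun hh => hc.2 (h5 hh), ξ, by_contra fun hh => hc.1 (h4 hh), rfl⟩
  have key := hN.hasSum hA (Lp.stronglyMeasurable (𝓕 f : L2 d)).measurable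
    (integrable_fourier hE hf) ((memLp_two_iff_integrable_sq_norm (Lp.aestronglyMeasurable _)).mp (Lp.memLp (𝓕 f : L2 d)))
  rw [integral_norm_sq_eq_norm_sq, Lp.norm_fourier_eq] at key
  exact key

end Sufficiency

/-! ### Test functions with two bumps -/

/-- Functions supported in a band are the Fourier transforms of elements of `V_E`. -/
theorem exists_mem_bandSpace {d : ℕ} {E : Set (EuclideanSpace ℝ (Fin d))}
    {F : EuclideanSpace ℝ (Fin d) → ℂ} (hF : MemLp F 2 volume) (hE : ∀ ξ ∉ E, F ξ = 0) :
    ∃ f ∈ bandSpace E, (∀ y, pointValue f y = 𝓕⁻ F y) ∧ ‖f‖ ^ 2 = ∫ x, ‖F x‖ ^ 2 := by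
  have hae := hF.coeFn_toLp
  have hinv : (𝓕 (𝓕⁻ (hF.toLp F) : L2 d) : L2 d) = hF.toLp F :=
    FourierTransform.fourier_fourierInv_eq _
  refine ⟨𝓕⁻ (hF.toLp F), ?_, fun y => ?_, ?_⟩
  · change ∀ᵐ ξ, ξ ∉ E → (𝓕 (𝓕⁻ (hF.toLp F) : L2 d) : L2 d) ξ = 0
    rw [hinv]
    filter_upwards [hae] with ξ hξ hξE
    rw [hξ, hE ξ hξE]
  · rw [pointValue, hinv, fourierInv_eq_integral_mul, fourierInv_eq_integral_mul]
    exact integral_congr_ae (hae.mono fun ξ hξ => by simp only [hξ])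
  · rw [← Lp.norm_fourier_eq, hinv, ← integral_norm_sq_eq_norm_sq]
    exact integral_congr_ae (hae.mono fun ξ hξ => by simp only [hξ])

/-- The function with value `a` on `S` and `b` on `S + α`, for `S` disjoint from `S + α`. -/
def twoBump {d : ℕ} (S : Set (EuclideanSpace ℝ (Fin d))) (α : EuclideanSpace ℝ (Fin d)) (a b : ℂ)
    (ξ : EuclideanSpace ℝ (Fin d)) : ℂ :=
  S.indicator (fun _ => a) ξ + S.indicator (fun _ => b) (ξ - α)

section TwoBump

variable {d : ℕ} {S : Set (EuclideanSpace ℝ (Fin d))} {α : EuclideanSpace ℝ (Fin d)} {a b : ℂ}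

theorem measurable_twoBump (hS : MeasurableSet S) : Measurable (twoBump S α a b) :=
  (measurable_const.indicator hS).add
    ((measurable_const.indicator hS).comp (measurable_id.sub_const α))

theorem mem_or_of_twoBump_ne_zero {ξ : EuclideanSpace ℝ (Fin d)} (h : twoBump S α a b ξ ≠ 0) :
    ξ ∈ S ∨ ξ - α ∈ S := by
  by_contra! hc
  exact h (by simp [twoBump, hc.1, hc.2])

theorem norm_twoBump_le (ξ : EuclideanSpace ℝ (Fin d)) : ‖twoBump S α a b ξ‖ ≤ ‖a‖ + ‖b‖ :=
  (norm_add_le _ _).trans (add_le_add (norm_indicator_le_norm_self (fun _ => a) _)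
    (norm_indicator_le_norm_self (fun _ => b) _))

theorem integral_indicator_const_sub (hS : MeasurableSet S) (c : ℂ)
    (v : EuclideanSpace ℝ (Fin d)) :
    ∫ ξ, S.indicator (fun _ => c) (ξ - v) = (volume.real S : ℂ) * c := by
  rw [integral_sub_right_eq_self (fun ξ => S.indicator (fun _ => c) ξ) v,
    integral_indicator_const _ hS, Complex.real_smul]

theorem integrable_indicator_const_sub (hS : MeasurableSet S) (hfin : volume S ≠ ⊤) (c : ℂ)
    (v : EuclideanSpace ℝ (Fin d)) :
    Integrable fun ξ => S.indicator (fun _ => c) (ξ - v) :=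
  ((integrable_indicator_iff hS).mpr (integrableOn_const hfin)).comp_sub_right v

theorem autocorrelation_twoBump_zero (hS : MeasurableSet S) (hfin : volume S ≠ ⊤)
    (h1 : ∀ u ∈ S, u + α ∉ S) :
    autocorrelation (twoBump S α a b) 0 = (volume.real S : ℂ) * (a * conj a + b * conj b) := by
  rw [mul_add, ← integral_indicator_const_sub hS _ 0, ← integral_indicator_const_sub hS _ α,
    ← integral_add (integrable_indicator_const_sub hS hfin _ _)
      (integrable_indicator_const_sub hS hfin _ _), autocorrelation]
  congr 1
  ext ξ
  have h3 := h1 (ξ - α)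
  rw [sub_add_cancel] at h3
  by_cases hu : ξ ∈ S <;> by_cases hv : ξ - α ∈ S <;> simp_all [twoBump]

/-- Translation by α carries S onto S + α, and S + α off the support, so a single cross term
survives. -/
theorem autocorrelation_twoBump (hS : MeasurableSet S) (h1 : ∀ u ∈ S, u + α ∉ S)
    (h2 : ∀ u ∈ S, u + α + α ∉ S) :
    autocorrelation (twoBump S α a b) α = (volume.real S : ℂ) * (a * conj b) := by
  rw [← integral_indicator_const_sub hS _ 0, autocorrelation]
  congr 1
  ext ξ
  have h3 := h1 (ξ - α)
  have h4 := h2 (ξ - α)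
  have h5 := h1 ξ
  rw [sub_add_cancel] at h3 h4
  by_cases hu : ξ ∈ S <;> by_cases hv : ξ - α ∈ S <;> by_cases hw : ξ + α ∈ S <;>
    simp_all [twoBump]

theorem autocorrelation_twoBump_neg (hS : MeasurableSet S) (h1 : ∀ u ∈ S, u + α ∉ S)
    (h2 : ∀ u ∈ S, u + α + α ∉ S) :
    autocorrelation (twoBump S α a b) (-α) = (volume.real S : ℂ) * (b * conj a) := by
  rw [← integral_indicator_const_sub hS _ α, autocorrelation]
  congr 1
  ext ξ
  have h3 := h1 (ξ - α)
  have h4 := h2 (ξ - α - α)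
  have h5 := h1 (ξ - α - α)
  rw [sub_add_cancel] at h3 h4 h5
  rw [sub_add_cancel] at h4
  rw [← sub_eq_add_neg]
  by_cases hu : ξ ∈ S <;> by_cases hv : ξ - α ∈ S <;> by_cases hw : ξ - α - α ∈ S <;>
    simp_all [twoBump]

end TwoBump

/-! ### Necessity -/

section Necessity

variable {d n : ℕ} {A : Fin n → Matrix (Fin d) (Fin d) ℝ}
  {β : Fin n → EuclideanSpace ℝ (Fin d)}

/-- Local finiteness of Λ isolates 0, α and -α. The bound δ ≤ ‖α‖ later keeps a set of diameter
below δ disjoint from its shifts by α and 2α. -/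
theorem exists_separation (hA : ∀ j, IsUnit (A j).det) {α : EuclideanSpace ℝ (Fin d)}
    (h0 : α ≠ 0) :
    ∃ δ > 0, δ ≤ ‖α‖ ∧ ∀ γ ∈ dualUnion A,
      (‖γ‖ < δ ∨ ‖γ - α‖ < δ ∨ ‖γ + α‖ < δ) → γ = 0 ∨ γ = α ∨ γ = -α := by
  set T : Set (EuclideanSpace ℝ (Fin d)) :=
    (dualUnion A ∩ Metric.closedBall 0 (2 * ‖α‖)) \ {0, α, -α} with hT
  have hTf : T.Finite := (finite_dualUnion_inter_closedBall hA _).sdiff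
  have hex : ∀ p ∈ ({0, α, -α} : Set (EuclideanSpace ℝ (Fin d))), ∃ ε > 0,
      Metric.ball p ε ⊆ Tᶜ := fun p hp =>
    Metric.isOpen_iff.mp hTf.isClosed.isOpen_compl p fun h => h.2 hp
  obtain ⟨ε₁, h₁, hb₁⟩ := hex 0 (by simp)
  obtain ⟨ε₂, h₂, hb₂⟩ := hex α (by simp)
  obtain ⟨ε₃, h₃, hb₃⟩ := hex (-α) (by simp)
  refine ⟨min ‖α‖ (min ε₁ (min ε₂ ε₃)), ?_, min_le_left _ _, fun γ hγ h => ?_⟩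
  · simp only [gt_iff_lt, lt_min_iff]
    exact ⟨norm_pos_iff.mpr h0, h₁, h₂, h₃⟩
  · by_contra hne
    have hne' : γ ∉ ({0, α, -α} : Set (EuclideanSpace ℝ (Fin d))) := by simpa using hne
    simp only [lt_min_iff] at h
    have hn : ‖γ‖ ≤ 2 * ‖α‖ := by
      rcases h with h | h | h
      · linarith [h.1, norm_nonneg α]
      · have := norm_add_le (γ - α) α
        rw [sub_add_cancel] at this
        linarith [h.1]
      · have := norm_sub_le (γ + α) α
        rw [add_sub_cancel_right] at this
        linarith [h.1]
    have hγT : γ ∈ T := ⟨⟨hγ, by simpa using hn⟩, hne'⟩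
    rcases h with h | h | h
    · exact hb₁ (by simpa using h.2.1) hγT
    · exact hb₂ (by simpa [dist_eq_norm] using h.2.2.1) hγT
    · exact hb₃ (by simpa [dist_eq_norm] using h.2.2.2) hγT

/-- Up to a null set, E ∩ (E - α) is a translate of E ∩ (E + α), hence has positive measure, and so
does its part near a suitable point. A Borel subset of E of full measure in E gives exact
inclusions. -/
theorem exists_small_overlap {E : Set (EuclideanSpace ℝ (Fin d))} (hE : IsBand E)
    {α : EuclideanSpace ℝ (Fin d)} (h : volume (E ∩ (fun x => x + α) '' E) ≠ 0) {δ : ℝ}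
    (hδ : 0 < δ) :
    ∃ S, MeasurableSet S ∧ volume S ≠ 0 ∧ volume S ≠ ⊤ ∧ (∀ u ∈ S, u ∈ E ∧ u + α ∈ E) ∧
      ∃ x, S ⊆ Metric.ball x (δ / 2) := by
  obtain ⟨E', hsub, hm, hae⟩ := hE.measurable.exists_measurable_subset_ae_eq
  set S₀ : Set (EuclideanSpace ℝ (Fin d)) := E' ∩ (fun x => x + α) ⁻¹' E' with hS₀
  have hS₀m : MeasurableSet S₀ := hm.inter ((measurable_id.add_const α) hm)
  have hpos : volume S₀ ≠ 0 := by
    intro h0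
    refine h (measure_eq_zero_iff_ae_notMem.mpr ?_)
    have hmem : ∀ᵐ x, x ∈ E' ↔ x ∈ E := hae.mem_iff
    have hq := (measurePreserving_sub_right (volume : Measure (EuclideanSpace ℝ (Fin d)))
      α).quasiMeasurePreserving
    filter_upwards [hmem, hq.ae hmem, hq.ae (measure_eq_zero_iff_ae_notMem.mp h0)] with x h1 h2 h3
    rintro ⟨hx, y, hy, rfl⟩
    simp only [add_sub_cancel_right] at h2 h3
    exact h3 ⟨h2.mpr hy, h1.mpr hx⟩
  obtain ⟨x, -, hx⟩ := exists_mem_forall_mem_nhdsWithin_pos_measure hpos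
  refine ⟨S₀ ∩ Metric.ball x (δ / 2), hS₀m.inter Metric.isOpen_ball.measurableSet,
    (hx _ ?_).ne', ?_, fun u hu => ⟨hsub hu.1.1, hsub hu.1.2⟩, x, Set.inter_subset_right⟩
  · exact Filter.inter_mem self_mem_nhdsWithin
      (mem_nhdsWithin_of_mem_nhds (Metric.ball_mem_nhds x (half_pos hδ)))
  · exact ((measure_mono Set.inter_subset_right).trans_lt measure_ball_lt_top).ne

theorem coefficient_eq_zero_of_isTight (hA : ∀ j, IsUnit (A j).det)
    {E : Set (EuclideanSpace ℝ (Fin d))} (hE : IsBand E) (hT : IsTight A β E)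
    {α : EuclideanSpace ℝ (Fin d)} (h0 : α ≠ 0)
    (h : volume (E ∩ (fun x => x + α) '' E) ≠ 0) : coefficient A β α = 0 := by
  classical
  obtain ⟨K, hK⟩ := hT
  obtain ⟨δ, hδ, hδα, hsep⟩ := exists_separation hA h0
  obtain ⟨S, hSm, hS0, hSfin, hSE, x, hSx⟩ := exists_small_overlap hE h hδ
  have hdist : ∀ u ∈ S, ∀ v ∈ S, ‖v - u‖ < δ := by
    intro u hu v hv
    have h1 := Metric.mem_ball.mp (hSx hu)
    have h2 := Metric.mem_ball.mp (hSx hv)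
    have := dist_triangle_right v u x
    rw [← dist_eq_norm]
    linarith
  have h1 : ∀ u ∈ S, u + α ∉ S := by
    intro u hu hv
    have := hdist u hu _ hv
    rw [add_sub_cancel_left] at this
    linarith
  have h2 : ∀ u ∈ S, u + α + α ∉ S := by
    intro u hu hv
    have := hdist u hu _ hv
    rw [add_assoc, add_sub_cancel_left, ← two_smul ℝ α, norm_smul] at this
    norm_num at this
    linarith [norm_nonneg α]
  have hm : (volume.real S : ℂ) ≠ 0 := by
    have : volume.real S ≠ 0 := (measureReal_ne_zero_iff hSfin).mpr hS0
    exact_mod_cast this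
  have key : ∀ a b : ℂ, coefficient A β 0 * (a * conj a + b * conj b) +
      (coefficient A β α * (a * conj b) + coefficient A β (-α) * (b * conj a)) =
      K * (a * conj a + b * conj b) := by
    intro a b
    have hFm : Measurable (twoBump S α a b) := measurable_twoBump hSm
    have hR : ∀ ξ, ‖x‖ + δ + ‖α‖ < ‖ξ‖ → twoBump S α a b ξ = 0 := by
      intro ξ hξ
      by_contra hne
      have hu : ∀ u ∈ S, ‖u‖ < ‖x‖ + δ := by
        intro u hu
        have h3 := Metric.mem_ball.mp (hSx hu)
        rw [dist_eq_norm] at h3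
        have := norm_add_le (u - x) x
        rw [sub_add_cancel] at this
        linarith
      rcases mem_or_of_twoBump_ne_zero hne with h3 | h3
      · linarith [hu _ h3, norm_nonneg α]
      · have := norm_add_le (ξ - α) α
        rw [sub_add_cancel] at this
        linarith [hu _ h3]
    have hsum := hasSum_sq_fourierInv hA β hFm norm_twoBump_le hR (S := {0, α, -α}) (by
      intro γ hγ hne
      obtain ⟨ξ, h3, h4⟩ := exists_ne_zero_of_autocorrelation_ne_zero hne
      -- Two points of S ∪ (S + α) differ by a vector within δ of 0, α or -α.
      have : γ = 0 ∨ γ = α ∨ γ = -α := by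
        refine hsep γ hγ ?_
        rcases mem_or_of_twoBump_ne_zero h3 with h3 | h3 <;>
          rcases mem_or_of_twoBump_ne_zero h4 with h4 | h4 <;> have h5 := hdist _ h3 _ h4
        · left; convert! h5 using 2; abel
        · right; left; convert! h5 using 2; abel
        · right; right; convert! h5 using 2; abel
        · left; convert! h5 using 2; abel
      simpa using this)
    have hα2 : α ≠ -α := fun hh => h0 (by
      have h3 : (2 : ℝ) • α = 0 := by rw [two_smul, add_eq_zero_iff_eq_neg]; exact hh
      exact (smul_eq_zero.mp h3).resolve_left two_ne_zero)
    rw [Finset.sum_insert (by simp [h0, h0.symm]), Finset.sum_insert (by simpa using hα2),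
      Finset.sum_singleton, autocorrelation_twoBump_zero hSm hSfin h1,
      autocorrelation_twoBump hSm h1 h2, autocorrelation_twoBump_neg hSm h1 h2] at hsum
    have hmem : MemLp (twoBump S α a b) 2 volume :=
      ((memLp_indicator_const 2 hSm a (Or.inr hSfin))).add
        ((memLp_indicator_const 2 hSm b (Or.inr hSfin)).comp_measurePreserving
          (measurePreserving_sub_right volume α))
    obtain ⟨f, hf, hfv, hfn⟩ := exists_mem_bandSpace (E := E) hmem (fun ξ hξ => by
      by_contra hne
      rcases mem_or_of_twoBump_ne_zero hne with h3 | h3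
      · exact hξ (hSE _ h3).1
      · exact hξ (by simpa using (hSE _ h3).2))
    have htight := hK f hf
    simp only [samplingTransform, hfv] at htight
    have heq := (Complex.hasSum_ofReal.mpr htight).unique hsum
    rw [hfn, Complex.ofReal_mul, ← autocorrelation_zero,
      autocorrelation_twoBump_zero hSm hSfin h1] at heq
    refine mul_left_cancel₀ hm ?_
    linear_combination -heq
  -- The first choice gives c(0) = K; the other two then give c(α) + c(-α) = 0 and c(α) - c(-α) = 0.
  have k1 := key 1 0
  have k2 := key 1 1
  have k3 := key Complex.I 1
  simp only [map_one, map_zero, mul_one, mul_zero, add_zero, one_mul,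
    Complex.conj_I, mul_neg, Complex.I_mul_I, neg_neg] at k1 k2 k3
  have hI := Complex.I_mul_I
  linear_combination (1 / 2) * k2 - (1 / 2) * Complex.I * k3 +
    (-1 + Complex.I) * k1 + (1 / 2) * (coefficient A β α - coefficient A β (-α)) * hI

end Necessity

end LatticeSampling

end

theorem mainTheorem5 {d n : ℕ} (A : Fin n → Matrix (Fin d) (Fin d) ℝ)
    (hA : ∀ j, IsUnit (A j).det) (β : Fin n → EuclideanSpace ℝ (Fin d))
    (E : Set (EuclideanSpace ℝ (Fin d))) (hE : LatticeSampling.IsBand E) :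
    LatticeSampling.IsTight A β E ↔
      ∀ α ∈ LatticeSampling.dualUnion A, α ≠ 0 →
        (volume (E ∩ (fun x => x + α) '' E) = 0 ∨
          ∑ j ∈ LatticeSampling.indexSet A α,
            ((|(A j).det|⁻¹ : ℝ) : ℂ) *
              Complex.exp (-2 * Real.pi * Complex.I * (inner ℝ (β j) α : ℝ)) = 0) :=
  ⟨fun hT _ _ h0 => or_iff_not_imp_left.mpr fun h =>
    LatticeSampling.coefficient_eq_zero_of_isTight hA hE hT h0 h,
    LatticeSampling.isTight_of_forall hA hE⟩
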